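/- **Model.** A project is a pair $(F,c)$, where $F$ is a probability distribution on $\mathbb{R}_+$ with finite expectation and $c\ge 0$. An agent has a finite family of projects $\mathcal{A}=\{a_i\}_{i=0}^n$, $a_i=(F_i,c_i)$, where $n\in\mathbb{N}$ is arbitrary; a principal knows only $a_0=(F_0,c_0)$. The prizes $y_i\sim F_i$ are independent, and the agent learns $y_i$ by sampling $a_i$ at cost $c_i$. A (limited-liability) contract is a measurable function $w:\mathbb{R}_+\to\mathbb{R}$ with $w(y)\ge 0$ for all $y$. Given $w$, the agent searches sequentially: as a (measurable) function of the set of projects sampled so far and of the highest wage available to him, he either samples a new project or stops. The prizes available to him are those he has sampled and the prize $0$, which he may always present. When he stops he presents one available prize $y$ with the highest wage $w(y)$, and receives $w(y)$ minus the costs of all projects sampled; the principal receives $y-w(y)$. Both are risk-neutral, and the agent breaks ties (between strategies, and between presented prizes) in favor of the principal. Let $\Sigma(w,\mathcal{A})$ be the set of search strategies that maximize the agent's expected payoff, and $$V_P(w\mid\mathcal{A})=\sup_{\sigma\in\Sigma(w,\mathcal{A})}\mathbb{E}_\sigma[y-w(y)],\qquad V_P(w)=\inf_{\mathcal{A}\ni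 a_0}V_P(w\mid\mathcal{A}),\qquad V_P=\sup_w V_P(w),$$ where expected payoffs take values in $[-\infty,\infty]$. A contract $w$ is robustly optimal if $V_P(w)=V_P$. **Theorem.** Let $s_0=\mathbb{E}_{F_0}[y]-c_0$, and suppose that $s_0>0$ or $c_0=0$. A contract $w$ is robustly optimal if and only if it satisfies the following two conditions. 1. (Minimum Debt Level) $w(y)\le [y-s_0]^+$ for all $y\in\mathbb{R}_+$. 2. (Full Surplus Extraction) $\mathbb{E}_{F_0}[w(y)]=c_0$. -/

import Mathlib

open MeasureTheory
open scoped NNReal ENNReal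

noncomputable section

namespace DelegatedSearch

/-- A project (Pandora's box): a prize distribution on `ℝ₊` with finite expectation, and a
nonnegative cost of learning the realized prize. -/
structure Project where
  dist : Measure ℝ≥0
  isProbabilityMeasure : IsProbabilityMeasure dist
  finiteMean : Integrable (fun y : ℝ≥0 => (y : ℝ)) dist
  cost : ℝ≥0

/-- The surplus `E[y] - c` of a project. -/
def Project.surplus (a : Project) : ℝ := (∫ y, (y : ℝ) ∂a.dist) - a.cost

/-- A limited-liability wage contract: a measurable function `w : ℝ₊ → ℝ` with `w ≥ 0`. -/
structure IsContract (w : ℝ≥0 → ℝ) : Prop where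
  measurable : Measurable w
  nonneg : ∀ y, 0 ≤ w y

/-- The highest wage available to the agent when the projects in `S` have been sampled and `y` is
the profile of prizes. Presenting a prize of zero is always possible. -/
def bestWage {N : ℕ} (w : ℝ≥0 → ℝ) (y : Fin N → ℝ≥0) (S : Finset (Fin N)) : ℝ :=
  S.fold max (w 0) (fun i => w (y i))

open Classical in
/-- The prize presented after sampling `S`: among the available prizes (those sampled and the zero
prize) that give the agent the highest wage, the one the principal prefers. As all of them cost
the same wage, this is the largest of them. -/
def presentedPrize {N : ℕ} (w : ℝ≥0 → ℝ) (y : Fin N → ℝ≥0) (S : Finset (Fin N)) : ℝ≥0 :=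
  ((insert 0 (S.image y)).filter (fun p => w p = bestWage w y S)).sup id

/-- A search strategy for `N` projects. From the set `S` of projects sampled so far and the highest
wage `t` available, it determines the project to be sampled next (`some i`, with `i` not
sampled yet) or to stop and present a prize (`none`). -/
structure Strategy (N : ℕ) where
  next : Finset (Fin N) → ℝ → Option (Fin N)
  fresh : ∀ S t i, next S t = some i → i ∉ S
  measurable_next : ∀ S o, MeasurableSet {t : ℝ | next S t = o}

namespace Strategy

variable {N : ℕ}

/-- The set of projects sampled in the first `k` steps when the prize profile is `y`. -/
def sampledAfter (σ : Strategy N) (w : ℝ≥0 → ℝ) (y : Fin N → ℝ≥0) : ℕ → Finset (Fin N)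
  | 0 => ∅
  | k + 1 =>
    match σ.next (sampledAfter σ w y k) (bestWage w y (sampledAfter σ w y k)) with
    | none => sampledAfter σ w y k
    | some i => insert i (sampledAfter σ w y k)

/-- The set of all projects sampled when the search is over. With `N` projects it has at most `N`
steps. -/
def sampled (σ : Strategy N) (w : ℝ≥0 → ℝ) (y : Fin N → ℝ≥0) : Finset (Fin N) :=
  σ.sampledAfter w y N

/-- The prize presented at the end of the search. -/
def prize (σ : Strategy N) (w : ℝ≥0 → ℝ) (y : Fin N → ℝ≥0) : ℝ≥0 :=
  presentedPrize w y (σ.sampled w y)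

end Strategy

/-- The expectation of a real random variable, as an extended real, `E[f⁺] - E[f⁻]`. It is
meaningful when at least one of the two terms is finite, which is the case in both uses below:
the principal's gain is bounded above by the sum of all prizes, and the agent's loss is bounded by
the sum of all costs. -/
def extExp {Ω : Type*} [MeasurableSpace Ω] (μ : Measure Ω) (f : Ω → ℝ) : EReal :=
  ((∫⁻ x, ENNReal.ofReal (f x) ∂μ : ℝ≥0∞) : EReal) -
    ((∫⁻ x, ENNReal.ofReal (-f x) ∂μ : ℝ≥0∞) : EReal)

section Payoffs

variable {N : ℕ}

/-- The joint law of the prizes of the projects `A`, which are independent. -/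
def prizeLaw (A : Fin N → Project) : Measure (Fin N → ℝ≥0) :=
  Measure.pi (fun i => (A i).dist)

/-- The agent's expected payoff: wage minus the costs of all sampled projects. -/
def agentPayoff (w : ℝ≥0 → ℝ) (A : Fin N → Project) (σ : Strategy N) : EReal :=
  extExp (prizeLaw A) (fun y => w (σ.prize w y) - ∑ i ∈ σ.sampled w y, ((A i).cost : ℝ))

/-- The principal's expected payoff: presented prize minus wage. -/
def principalPayoff (w : ℝ≥0 → ℝ) (A : Fin N → Project) (σ : Strategy N) : EReal :=
  extExp (prizeLaw A) (fun y => (σ.prize w y : ℝ) - w (σ.prize w y))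

/-- The agent's optimal search strategies, `Σ(w, A)`. -/
def optimalStrategies (w : ℝ≥0 → ℝ) (A : Fin N → Project) : Set (Strategy N) :=
  {σ | ∀ σ' : Strategy N, agentPayoff w A σ' ≤ agentPayoff w A σ}

/-- The principal's payoff `V_P(w | A)`, when the agent breaks ties in favor of the principal. -/
def principalValue (w : ℝ≥0 → ℝ) (A : Fin N → Project) : EReal :=
  ⨆ σ ∈ optimalStrategies w A, principalPayoff w A σ

end Payoffs

/-- The set of projects that consists of the known project `a₀` and the `n` further projects `b`. -/
def withKnown (a₀ : Project) {n : ℕ} (b : Fin n → Project) : Fin (n + 1) → Project :=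
  Fin.cons a₀ b

/-- The payoff guarantee `V_P(w)`: the worst case over all finite sets of projects that contain the
known project `a₀`. -/
def guarantee (a₀ : Project) (w : ℝ≥0 → ℝ) : EReal :=
  ⨅ (n : ℕ) (b : Fin n → Project), principalValue w (withKnown a₀ b)

/-- The maximal payoff guarantee `V_P` over all limited-liability contracts. -/
def optimalGuarantee (a₀ : Project) : EReal :=
  ⨆ (w : ℝ≥0 → ℝ) (_ : IsContract w), guarantee a₀ w

/-- A contract is robustly optimal if it achieves the maximal payoff guarantee. -/
def RobustlyOptimal (a₀ : Project) (w : ℝ≥0 → ℝ) : Prop :=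
  IsContract w ∧ guarantee a₀ w = optimalGuarantee a₀

end DelegatedSearch

end

namespace DelegatedSearch

/-! Write `s` for the surplus of `a₀`. The maximal guarantee equals `s`, so optimality means
guaranteeing `s`. No contract guarantees more: if `a₀` is the only project, the principal gets at
most its surplus less the agent's rent (`guarantee_le_surplus`).

Sufficiency. Full extraction makes `a₀` by itself worth exactly zero to the agent. His value
function has slope at most one in the highest wage in hand, so a project worth zero alone adds
nothing alongside others. It is therefore optimal to search the other projects optimally and open
`a₀` only if no positive wage was found (`lastResort_optimal`). If `a₀` stays closed, a positive
wage is paid and the debt bound leaves the principal at least `s`. If `a₀` is opened, its wage is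
the highest, and the principal gets at least `y₀ - w y₀`, where `y₀` is the prize of `a₀`. Opening
is independent of `y₀`, and `y₀ - w y₀` has mean `s`; hence `le_principalValue`. Scaling down the
debt contract produces a contract with both properties.

Necessity. With `a₀` alone, any rent of the agent is lost to the principal, and too low a wage stops
the search; this forces extraction (`integral_wage_eq_cost`). If the debt bound fails at a prize
`p`, add a free project that surely yields `p`. Since `a₀` is worth zero and `w p > 0`, every
optimal strategy presents `p` almost surely (`principalPayoff_eq_of_certainProject`), leaving `p - w
p < s`. -/

instance (a : Project) : IsProbabilityMeasure a.dist := a.isProbabilityMeasure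

instance {N : ℕ} (A : Fin N → Project) : IsProbabilityMeasure (prizeLaw A) := by
  unfold prizeLaw; infer_instance

/-! ### Expectations in the extended reals. -/

section Expectation

variable {Ω : Type*} [MeasurableSpace Ω] {μ : Measure Ω} {f g : Ω → ℝ}

theorem extExp_mono_ae (h : f ≤ᵐ[μ] g) : extExp μ f ≤ extExp μ g := by
  unfold extExp
  refine EReal.sub_le_sub ?_ ?_
  · refine EReal.coe_ennreal_le_coe_ennreal_iff.2 (lintegral_mono_ae ?_)
    filter_upwards [h] with x hx using ENNReal.ofReal_le_ofReal hx
  · refine EReal.coe_ennreal_le_coe_ennreal_iff.2 (lintegral_mono_ae ?_)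
    filter_upwards [h] with x hx using ENNReal.ofReal_le_ofReal (neg_le_neg hx)

theorem extExp_mono (h : ∀ x, f x ≤ g x) : extExp μ f ≤ extExp μ g :=
  extExp_mono_ae (Filter.Eventually.of_forall h)

theorem extExp_congr_ae (h : f =ᵐ[μ] g) : extExp μ f = extExp μ g :=
  le_antisymm (extExp_mono_ae h.le) (extExp_mono_ae h.symm.le)

theorem lintegral_ofReal_lt_top (hf : Integrable f μ) : ∫⁻ x, ENNReal.ofReal (f x) ∂μ < ⊤ :=
  lt_of_le_of_lt (lintegral_mono fun x => by
    rw [Real.enorm_eq_ofReal_abs]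
    exact ENNReal.ofReal_le_ofReal (le_abs_self _)) hf.2

theorem extExp_of_integrable (hf : Integrable f μ) :
    extExp μ f = ((∫ x, f x ∂μ : ℝ) : EReal) := by
  unfold extExp
  rw [integral_eq_lintegral_pos_part_sub_lintegral_neg_part hf, EReal.coe_sub,
    EReal.coe_ennreal_toReal (lintegral_ofReal_lt_top hf).ne,
    EReal.coe_ennreal_toReal (x := ∫⁻ x, ENNReal.ofReal (-f x) ∂μ)
      (lintegral_ofReal_lt_top hf.neg).ne]

theorem extExp_const [IsProbabilityMeasure μ] (c : ℝ) : extExp μ (fun _ => c) = (c : EReal) := by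
  rw [extExp_of_integrable (integrable_const c)]
  simp

/-- A random variable that is bounded below by an integrable one but is not itself integrable has
infinite expectation. -/
theorem extExp_eq_top (hf : AEStronglyMeasurable f μ) (hg : Integrable g μ) (hgf : g ≤ᵐ[μ] f)
    (hf' : ¬ Integrable f μ) : extExp μ f = ⊤ := by
  have hneg : ∫⁻ x, ENNReal.ofReal (-f x) ∂μ < ⊤ :=
    lt_of_le_of_lt (lintegral_mono_ae (by
      filter_upwards [hgf] with x hx using ENNReal.ofReal_le_ofReal (neg_le_neg hx)))
      (lintegral_ofReal_lt_top hg.neg)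
  have hpos : ∫⁻ x, ENNReal.ofReal (f x) ∂μ = ⊤ := by
    by_contra hne
    refine hf' ⟨hf, ?_⟩
    refine lt_of_le_of_lt (b := ∫⁻ x, (ENNReal.ofReal (f x) + ENNReal.ofReal (-f x)) ∂μ)
      (lintegral_mono fun x => ?_) ?_
    · rw [Real.enorm_eq_ofReal_abs]
      rcases abs_cases (f x) with ⟨h, _⟩ | ⟨h, _⟩ <;> rw [h]
      · exact le_self_add
      · exact le_add_self
    · rw [lintegral_add_left' hf.aemeasurable.ennreal_ofReal]
      exact ENNReal.add_lt_top.2 ⟨lt_top_iff_ne_top.2 hne, hneg⟩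
  unfold extExp
  rw [hpos, EReal.coe_ennreal_top, EReal.top_sub]
  simpa using hneg.ne

/-- The value `⊤` forces an infinite positive part, and in `EReal` anything plus `⊥` is `⊥`, so the
other part need not be controlled. -/
theorem extExp_neg (hf : extExp μ f = ⊤) : extExp μ (fun x => -f x) = ⊥ := by
  unfold extExp at *
  simp only [neg_neg]
  have h1 : ∫⁻ x, ENNReal.ofReal (f x) ∂μ = ⊤ := by
    by_contra h
    lift ∫⁻ x, ENNReal.ofReal (f x) ∂μ to ℝ≥0 using h with a
    generalize ∫⁻ x, ENNReal.ofReal (-f x) ∂μ = b at hf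
    induction b using ENNReal.recTopCoe with
    | top => simp at hf
    | coe b =>
      rw [EReal.coe_nnreal_eq_coe_real, EReal.coe_nnreal_eq_coe_real, ← EReal.coe_sub] at hf
      exact EReal.coe_ne_top _ hf
  rw [h1, EReal.coe_ennreal_top, sub_eq_add_neg, EReal.neg_top, EReal.add_bot]

end Expectation

/-! ### Resampling one coordinate of a product measure. -/

section ProductMeasure

variable {ι : Type*} [Fintype ι] [DecidableEq ι] {X : ι → Type*} [∀ i, MeasurableSpace (X i)]
  (μ : ∀ i, Measure (X i)) [∀ i, IsProbabilityMeasure (μ i)]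

/-- Replacing one coordinate by an independent copy does not change a product measure. -/
theorem measurePreserving_update (i : ι) :
    MeasurePreserving (fun p : (∀ j, X j) × X i => Function.update p.1 i p.2)
      ((Measure.pi μ).prod (μ i)) (Measure.pi μ) := by
  refine ⟨measurable_update', (Measure.pi_eq fun s hs => ?_).symm⟩
  rw [Measure.map_apply measurable_update' (MeasurableSet.univ_pi hs)]
  have : (fun p : (∀ j, X j) × X i => Function.update p.1 i p.2) ⁻¹' Set.univ.pi s =
      (Set.univ.pi (Function.update s i Set.univ)) ×ˢ s i := by
    ext ⟨y, z⟩
    simp only [Set.mem_preimage, Set.mem_univ_pi, Set.mem_prod]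
    constructor
    · refine fun h => ⟨fun j => ?_, by simpa using h i⟩
      by_cases hj : j = i
      · subst hj; simp
      · simpa [hj] using h j
    · rintro ⟨h, hz⟩ j
      by_cases hj : j = i
      · subst hj; simpa using hz
      · simpa [hj] using h j
  rw [this, Measure.prod_prod, Measure.pi_pi,
    ← Finset.mul_prod_erase Finset.univ (fun j => μ j (s j)) (Finset.mem_univ i),
    ← Finset.mul_prod_erase Finset.univ _ (Finset.mem_univ i)]
  rw [Function.update_self, measure_univ, one_mul, mul_comm]
  congr 1
  refine Finset.prod_congr rfl fun j hj => ?_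
  rw [Function.update_of_ne (Finset.ne_of_mem_erase hj)]

/-- This is how independence enters: the prize of a project can be redrawn after the decision to
sample it is fixed. -/
theorem integral_pi_update (i : ι) {f : (∀ j, X j) → ℝ} (hf : Integrable f (Measure.pi μ)) :
    ∫ y, f y ∂Measure.pi μ = ∫ y, ∫ z, f (Function.update y i z) ∂μ i ∂Measure.pi μ := by
  have hmp := measurePreserving_update μ i
  conv_lhs => rw [← hmp.map_eq]
  rw [integral_map hmp.measurable.aemeasurable (by rw [hmp.map_eq]; exact hf.1)]
  exact integral_prod _ (hmp.integrable_comp_of_integrable hf)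

end ProductMeasure

/-! ### The highest available wage and the presented prize. -/

section BestWage

variable {N : ℕ} {w : ℝ≥0 → ℝ} {y : Fin N → ℝ≥0} {S : Finset (Fin N)}

@[simp] theorem bestWage_empty : bestWage w y ∅ = w 0 := by simp [bestWage]

theorem bestWage_insert (i : Fin N) :
    bestWage w y (insert i S) = max (w (y i)) (bestWage w y S) :=
  Finset.fold_insert_idem

theorem bestWage_le_iff {t : ℝ} : bestWage w y S ≤ t ↔ w 0 ≤ t ∧ ∀ i ∈ S, w (y i) ≤ t :=
  Finset.fold_max_le _

theorem le_bestWage_zero : w 0 ≤ bestWage w y S := (bestWage_le_iff.1 le_rfl).1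

theorem bestWage_nonneg (hw : IsContract w) : 0 ≤ bestWage w y S :=
  (hw.nonneg 0).trans le_bestWage_zero

theorem bestWage_congr {y' : Fin N → ℝ≥0} (h : ∀ i ∈ S, y i = y' i) :
    bestWage w y S = bestWage w y' S :=
  Finset.fold_congr fun i hi => by rw [h i hi]

theorem bestWage_update {i : Fin N} (hi : i ∉ S) (z : ℝ≥0) :
    bestWage w (Function.update y i z) S = bestWage w y S :=
  bestWage_congr fun _ hj => Function.update_of_ne (ne_of_mem_of_not_mem hj hi) _ _

theorem bestWage_le_sum (hw : IsContract w) : bestWage w y S ≤ w 0 + ∑ i, w (y i) := by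
  refine bestWage_le_iff.2 ⟨?_, fun i _ => ?_⟩
  · exact le_add_of_nonneg_right (Finset.sum_nonneg fun i _ => hw.nonneg _)
  · have := Finset.single_le_sum (f := fun i => w (y i)) (fun i _ => hw.nonneg _)
      (Finset.mem_univ i)
    have := hw.nonneg 0
    linarith

theorem measurable_bestWage (hw : IsContract w) (S : Finset (Fin N)) :
    Measurable fun y : Fin N → ℝ≥0 => bestWage w y S := by
  induction S using Finset.induction_on with
  | empty => simp
  | insert i S _ ih =>
    simp only [bestWage_insert]
    exact (hw.measurable.comp (measurable_pi_apply i)).max ih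

theorem exists_eq_bestWage (w : ℝ≥0 → ℝ) (y : Fin N → ℝ≥0) (S : Finset (Fin N)) :
    ∃ p, (p = 0 ∨ ∃ i ∈ S, y i = p) ∧ w p = bestWage w y S := by
  induction S using Finset.induction_on with
  | empty => exact ⟨0, by simp⟩
  | insert i S _ ih =>
    obtain ⟨p, hp, hp'⟩ := ih
    rw [bestWage_insert]
    rcases le_total (w (y i)) (bestWage w y S) with h | h
    · refine ⟨p, ?_, by rw [max_eq_right h, hp']⟩
      rcases hp with hp | ⟨j, hj, hj'⟩
      · exact Or.inl hp
      · exact Or.inr ⟨j, Finset.mem_insert_of_mem hj, hj'⟩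
    · exact ⟨y i, Or.inr ⟨i, Finset.mem_insert_self _ _, rfl⟩, (max_eq_left h).symm⟩

theorem presentedPrize_spec (w : ℝ≥0 → ℝ) (y : Fin N → ℝ≥0) (S : Finset (Fin N)) :
    (presentedPrize w y S = 0 ∨ ∃ i ∈ S, y i = presentedPrize w y S) ∧
      w (presentedPrize w y S) = bestWage w y S := by
  classical
  obtain ⟨p, hp, hp'⟩ := exists_eq_bestWage w y S
  -- Nonemptiness makes the supremum an attained one rather than the default `0` of an empty set.
  have hne : ((insert 0 (S.image y)).filter (fun p => w p = bestWage w y S)).Nonempty :=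
    ⟨p, by
      rw [Finset.mem_filter, Finset.mem_insert, Finset.mem_image]
      exact ⟨hp, hp'⟩⟩
  obtain ⟨q, hq, hq'⟩ := Finset.exists_mem_eq_sup _ hne id
  have : presentedPrize w y S = q := by
    rw [presentedPrize]
    simpa using hq'
  rw [this]
  simpa using hq

theorem w_presentedPrize : w (presentedPrize w y S) = bestWage w y S :=
  (presentedPrize_spec w y S).2

theorem le_presentedPrize {i : Fin N} (hi : i ∈ S) (h : w (y i) = bestWage w y S) :
    y i ≤ presentedPrize w y S := by
  classical
  unfold presentedPrize
  refine Finset.le_sup (f := id) (b := y i) ?_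
  rw [Finset.mem_filter]
  exact ⟨Finset.mem_insert_of_mem (Finset.mem_image_of_mem _ hi), h⟩

end BestWage

/-! ### The course of a search: termination, non-anticipation, measurability. -/

namespace Strategy

variable {N : ℕ} {w : ℝ≥0 → ℝ} {y : Fin N → ℝ≥0} (σ : Strategy N)

theorem sampledAfter_succ_of_none {k : ℕ}
    (h : σ.next (σ.sampledAfter w y k) (bestWage w y (σ.sampledAfter w y k)) = none) :
    σ.sampledAfter w y (k + 1) = σ.sampledAfter w y k := by
  rw [sampledAfter, h]

theorem sampledAfter_succ_of_some {k : ℕ} {i : Fin N}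
    (h : σ.next (σ.sampledAfter w y k) (bestWage w y (σ.sampledAfter w y k)) = some i) :
    σ.sampledAfter w y (k + 1) = insert i (σ.sampledAfter w y k) := by
  rw [sampledAfter, h]

theorem sampledAfter_subset_succ (k : ℕ) :
    σ.sampledAfter w y k ⊆ σ.sampledAfter w y (k + 1) := by
  cases h : σ.next (σ.sampledAfter w y k) (bestWage w y (σ.sampledAfter w y k)) with
  | none => rw [σ.sampledAfter_succ_of_none h]
  | some i => rw [σ.sampledAfter_succ_of_some h]; exact Finset.subset_insert _ _

/-- Every active step adds a fresh project, and a stopped search keeps its state and so remains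
stopped. -/
theorem next_sampledAfter_eq_none_or_card (w : ℝ≥0 → ℝ) (y : Fin N → ℝ≥0) (k : ℕ) :
    σ.next (σ.sampledAfter w y k) (bestWage w y (σ.sampledAfter w y k)) = none ∨
      (σ.sampledAfter w y k).card = k := by
  induction k with
  | zero => exact Or.inr rfl
  | succ k ih =>
    cases h : σ.next (σ.sampledAfter w y k) (bestWage w y (σ.sampledAfter w y k)) with
    | none =>
      left
      rw [σ.sampledAfter_succ_of_none h, h]
    | some i =>
      right
      rw [σ.sampledAfter_succ_of_some h, Finset.card_insert_of_notMem (σ.fresh _ _ _ h)]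
      rcases ih with h' | h'
      · rw [h] at h'; cases h'
      · rw [h']

/-- The search is over after `N` steps. -/
theorem next_sampled (w : ℝ≥0 → ℝ) (y : Fin N → ℝ≥0) :
    σ.next (σ.sampled w y) (bestWage w y (σ.sampled w y)) = none := by
  rcases σ.next_sampledAfter_eq_none_or_card w y N with h | h
  · exact h
  · have huniv : σ.sampled w y = Finset.univ :=
      Finset.eq_univ_of_card _ (by rw [Fintype.card_fin]; exact h)
    cases hn : σ.next (σ.sampled w y) (bestWage w y (σ.sampled w y)) with
    | none => rfl
    | some i => exact absurd (huniv ▸ Finset.mem_univ i) (σ.fresh _ _ _ hn)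

/-- The search does not depend on the prize of a project that has not been sampled. -/
theorem sampledAfter_update {k : ℕ} {i : Fin N} (hi : i ∉ σ.sampledAfter w y k) (z : ℝ≥0) :
    σ.sampledAfter w (Function.update y i z) k = σ.sampledAfter w y k := by
  induction k with
  | zero => rfl
  | succ k ih =>
    have hk : i ∉ σ.sampledAfter w y k := fun h => hi (σ.sampledAfter_subset_succ k h)
    have ih := ih hk
    have hb : bestWage w (Function.update y i z) (σ.sampledAfter w (Function.update y i z) k) =
        bestWage w y (σ.sampledAfter w y k) := by rw [ih, bestWage_update hk]
    rw [sampledAfter, sampledAfter, hb, ih]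

theorem mem_sampledAfter_update {k : ℕ} {i : Fin N} (z : ℝ≥0) :
    i ∈ σ.sampledAfter w (Function.update y i z) k ↔ i ∈ σ.sampledAfter w y k := by
  constructor
  · intro h
    by_contra h'
    exact h' (σ.sampledAfter_update h' z ▸ h)
  · intro h
    by_contra h'
    -- The update is undone by writing the original prize back.
    have := σ.sampledAfter_update h' (y i)
    rw [Function.update_idem, Function.update_eq_self] at this
    exact h' (this ▸ h)

theorem measurableSet_sampledAfter_eq (hw : IsContract w) (k : ℕ) (S : Finset (Fin N)) :
    MeasurableSet {y | σ.sampledAfter w y k = S} := by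
  induction k generalizing S with
  | zero => exact MeasurableSet.const (∅ = S)
  | succ k ih =>
    have : {y | σ.sampledAfter w y (k + 1) = S} =
        ⋃ (T : Finset (Fin N)) (o : Option (Fin N)),
          ({y | σ.sampledAfter w y k = T} ∩ {y | σ.next T (bestWage w y T) = o}) ∩
            {_y | (match o with | none => T | some i => insert i T) = S} := by
      ext y
      simp only [Set.mem_ofPred_eq, Set.mem_iUnion, Set.mem_inter_iff]
      constructor
      · intro h
        exact ⟨_, _, ⟨rfl, rfl⟩, h⟩
      · rintro ⟨T, o, ⟨rfl, rfl⟩, h⟩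
        exact h
    rw [this]
    refine MeasurableSet.iUnion fun T => MeasurableSet.iUnion fun o => ?_
    exact ((ih T).inter (measurable_bestWage hw T (σ.measurable_next T o))).inter
      (MeasurableSet.const _)

theorem measurableSet_mem_sampled (hw : IsContract w) (i : Fin N) :
    MeasurableSet {y | i ∈ σ.sampled w y} := by
  have : {y | i ∈ σ.sampled w y} =
      ⋃ (S : Finset (Fin N)), {y | σ.sampledAfter w y N = S} ∩ {_y | i ∈ S} := by
    ext y
    simp [sampled]
  rw [this]
  exact MeasurableSet.iUnion fun S =>
    (σ.measurableSet_sampledAfter_eq hw N S).inter (MeasurableSet.const _)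

theorem w_prize (w : ℝ≥0 → ℝ) (y : Fin N → ℝ≥0) :
    w (σ.prize w y) = bestWage w y (σ.sampled w y) := w_presentedPrize

end Strategy

/-! ### Potentials along a search: the supermartingale inequality. -/

section Verification

variable {N : ℕ} {w : ℝ≥0 → ℝ} {A : Fin N → Project}

theorem integrable_comp_eval (A : Fin N → Project) (i : Fin N) {f : ℝ≥0 → ℝ}
    (hf : Integrable f (A i).dist) : Integrable (fun y : Fin N → ℝ≥0 => f (y i)) (prizeLaw A) :=
  (measurePreserving_eval (fun i => (A i).dist) i).integrable_comp_of_integrable hf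

theorem integral_comp_eval (A : Fin N → Project) (i : Fin N) {f : ℝ≥0 → ℝ}
    (hf : Integrable f (A i).dist) :
    ∫ y, f (y i) ∂prizeLaw A = ∫ z, f z ∂(A i).dist := by
  have hmp := measurePreserving_eval (fun i => (A i).dist) i
  conv_rhs => rw [← hmp.map_eq]
  rw [integral_map hmp.measurable.aemeasurable (by rw [hmp.map_eq]; exact hf.1)]
  rfl

/-- The function composed with the state of the search after `k` steps: the set of projects
sampled and the highest wage available. -/
theorem measurable_state (σ : Strategy N) (hw : IsContract w) (k : ℕ)
    {Φ : Finset (Fin N) → ℝ → ℝ} (hΦ : ∀ S, Measurable (Φ S)) :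
    Measurable fun y => Φ (σ.sampledAfter w y k) (bestWage w y (σ.sampledAfter w y k)) := by
  classical
  have : (fun y => Φ (σ.sampledAfter w y k) (bestWage w y (σ.sampledAfter w y k))) =
      fun y => ∑ S, Set.indicator {y | σ.sampledAfter w y k = S}
        (fun y => Φ S (bestWage w y S)) y := by
    funext y
    rw [Finset.sum_eq_single (σ.sampledAfter w y k)]
    · rw [Set.indicator_of_mem]; rfl
    · intro S _ hS
      exact Set.indicator_of_notMem (fun h => hS h.symm) _
    · simp
  rw [this]
  refine Finset.measurable_sum _ fun S _ => ?_
  exact ((hΦ S).comp (measurable_bestWage hw S)).indicator (σ.measurableSet_sampledAfter_eq hw k S)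

theorem abs_bestWage_le (hw : IsContract w) (y : Fin N → ℝ≥0) (S : Finset (Fin N)) :
    |bestWage w y S| ≤ w 0 + ∑ i, w (y i) := by
  rw [abs_of_nonneg (bestWage_nonneg hw)]
  exact bestWage_le_sum hw

theorem integrable_wage_bound (hi : ∀ i, Integrable w (A i).dist) (K : ℝ) :
    Integrable (fun y : Fin N → ℝ≥0 => K + (w 0 + ∑ i, w (y i))) (prizeLaw A) :=
  (integrable_const K).add ((integrable_const _).add
    (integrable_finsetSum _ fun i _ => integrable_comp_eval A i (hi i)))

theorem integrable_state (σ : Strategy N) (hw : IsContract w)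
    (hi : ∀ i, Integrable w (A i).dist) (k : ℕ)
    {Φ : Finset (Fin N) → ℝ → ℝ} (hΦ : ∀ S, Measurable (Φ S)) {K : ℝ}
    (hK : ∀ S t, |Φ S t| ≤ K + |t|) :
    Integrable (fun y => Φ (σ.sampledAfter w y k) (bestWage w y (σ.sampledAfter w y k)))
      (prizeLaw A) := by
  refine (integrable_wage_bound hi K).mono' (measurable_state σ hw k hΦ).aestronglyMeasurable
    (Filter.Eventually.of_forall fun y => (hK _ _).trans ?_)
  gcongr
  exact abs_bestWage_le hw _ _

/-- If no sampling decision of the strategy increases the expected value of `Φ`, then this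
expected value does not increase in a step of the search. -/
theorem integral_step_le (σ : Strategy N) (hw : IsContract w)
    (hi : ∀ i, Integrable w (A i).dist) (k : ℕ)
    {Φ : Finset (Fin N) → ℝ → ℝ} (hΦ : ∀ S, Measurable (Φ S)) {K : ℝ}
    (hK : ∀ S t, |Φ S t| ≤ K + |t|)
    (hstep : ∀ S i t, 0 ≤ t → σ.next S t = some i →
      ∫ z, Φ (insert i S) (max (w z) t) ∂(A i).dist ≤ Φ S t) :
    ∫ y, Φ (σ.sampledAfter w y (k + 1)) (bestWage w y (σ.sampledAfter w y (k + 1)))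
        ∂prizeLaw A ≤
      ∫ y, Φ (σ.sampledAfter w y k) (bestWage w y (σ.sampledAfter w y k)) ∂prizeLaw A := by
  classical
  rw [← sub_nonpos, ← integral_sub (integrable_state σ hw hi (k + 1) hΦ hK)
    (integrable_state σ hw hi k hΦ hK)]
  -- The increment is split by state and decision: on `D S i` the search is at `S` and samples `i`,
  -- which changes the potential by `F S i`.
  set D : Finset (Fin N) → Fin N → Set (Fin N → ℝ≥0) := fun S i =>
    {y | σ.sampledAfter w y k = S} ∩ {y | σ.next S (bestWage w y S) = some i} with hD
  set F : Finset (Fin N) → Fin N → (Fin N → ℝ≥0) → ℝ := fun S i y =>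
    Φ (insert i S) (max (w (y i)) (bestWage w y S)) - Φ S (bestWage w y S) with hF
  have hdecomp : ∀ y, Φ (σ.sampledAfter w y (k + 1)) (bestWage w y (σ.sampledAfter w y (k + 1))) -
      Φ (σ.sampledAfter w y k) (bestWage w y (σ.sampledAfter w y k)) =
      ∑ S, ∑ i, (D S i).indicator (F S i) y := by
    intro y
    rw [Finset.sum_eq_single (σ.sampledAfter w y k)]
    · cases h : σ.next (σ.sampledAfter w y k) (bestWage w y (σ.sampledAfter w y k)) with
      | none =>
        rw [σ.sampledAfter_succ_of_none h, sub_self, Finset.sum_eq_zero]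
        intro i _
        refine Set.indicator_of_notMem (fun hy => ?_) _
        have := hy.2
        rw [Set.mem_ofPred_eq, h] at this
        cases this
      | some i =>
        rw [σ.sampledAfter_succ_of_some h, bestWage_insert, Finset.sum_eq_single i]
        · rw [Set.indicator_of_mem]
          exact ⟨rfl, h⟩
        · intro j _ hj
          refine Set.indicator_of_notMem (fun hy => hj ?_) _
          have := hy.2
          rw [Set.mem_ofPred_eq, h] at this
          exact (Option.some.inj this).symm
        · simp
    · intro S _ hS
      refine Finset.sum_eq_zero fun i _ => Set.indicator_of_notMem (fun hy => hS hy.1.symm) _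
    · simp
  simp only [hdecomp]
  have hDm : ∀ S i, MeasurableSet (D S i) := fun S i =>
    (σ.measurableSet_sampledAfter_eq hw k S).inter
      (measurable_bestWage hw S (σ.measurable_next S (some i)))
  have hFm : ∀ S i, Measurable (F S i) := fun S i =>
    ((hΦ _).comp ((hw.measurable.comp (measurable_pi_apply i)).max
      (measurable_bestWage hw S))).sub ((hΦ S).comp (measurable_bestWage hw S))
  have hFi : ∀ S i, Integrable (F S i) (prizeLaw A) := by
    intro S i
    refine ((integrable_wage_bound hi K).add (integrable_wage_bound hi K)).mono'
      (hFm S i).aestronglyMeasurable (Filter.Eventually.of_forall fun y => ?_)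
    refine (abs_sub _ _).trans (add_le_add ((hK _ _).trans ?_) ((hK _ _).trans ?_))
    · rw [← bestWage_insert]
      exact add_le_add le_rfl (abs_bestWage_le hw _ _)
    · exact add_le_add le_rfl (abs_bestWage_le hw _ _)
  rw [integral_finsetSum _ fun S _ => integrable_finsetSum _ fun i _ =>
    (hFi S i).indicator (hDm S i)]
  refine Finset.sum_nonpos fun S _ => ?_
  rw [integral_finsetSum _ fun i _ => (hFi S i).indicator (hDm S i)]
  refine Finset.sum_nonpos fun i _ => ?_
  by_cases hiS : i ∈ S
  · have : D S i = ∅ := by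
      ext y
      simp only [Set.mem_empty_iff_false, iff_false]
      exact fun hy => σ.fresh _ _ _ hy.2 hiS
    simp [this]
  · unfold prizeLaw
    rw [integral_pi_update _ i ((hFi S i).indicator (hDm S i))]
    refine integral_nonpos fun y => ?_
    -- As `i` is not in `S`, the event does not look at its prize, so the inner integral is the
    -- conditional expectation bounded by `hstep`.
    have hmem : ∀ z, Function.update y i z ∈ D S i ↔ y ∈ D S i := by
      intro z
      simp only [hD, Set.mem_inter_iff, Set.mem_ofPred_eq, bestWage_update hiS]
      refine and_congr_left fun _ => ⟨fun h => ?_, fun h => ?_⟩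
      · have h' : i ∉ σ.sampledAfter w y k := by
          rw [← σ.mem_sampledAfter_update z, h]; exact hiS
        rw [← h, σ.sampledAfter_update h']
      · rw [σ.sampledAfter_update (by rw [h]; exact hiS), h]
    by_cases hy : y ∈ D S i
    · have : ∀ z, (D S i).indicator (F S i) (Function.update y i z) =
          Φ (insert i S) (max (w z) (bestWage w y S)) - Φ S (bestWage w y S) := by
        intro z
        rw [Set.indicator_of_mem ((hmem z).2 hy)]
        simp only [hF, bestWage_update hiS, Function.update_self]
      simp only [this]
      rw [integral_sub _ (integrable_const _)]
      · have := hstep S i _ (bestWage_nonneg hw) hy.2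
        simpa using this
      · refine ((integrable_const (K + |bestWage w y S|)).add (hi i)).mono'
          ((hΦ _).comp (hw.measurable.max measurable_const)).aestronglyMeasurable
          (Filter.Eventually.of_forall fun z => (hK _ _).trans ?_)
        simp only [Pi.add_apply]
        have h0 := bestWage_nonneg (y := y) (S := S) hw
        have h1 := hw.nonneg z
        rw [abs_of_nonneg (h1.trans (le_max_left _ _)), abs_of_nonneg h0]
        have := max_le_add_of_nonneg h1 h0
        linarith
    · have : ∀ z, (D S i).indicator (F S i) (Function.update y i z) = 0 := fun z =>
        Set.indicator_of_notMem (fun h => hy ((hmem z).1 h)) _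
      simp [this]

theorem integral_sampled_le (σ : Strategy N) (hw : IsContract w)
    (hi : ∀ i, Integrable w (A i).dist)
    {Φ : Finset (Fin N) → ℝ → ℝ} (hΦ : ∀ S, Measurable (Φ S)) {K : ℝ}
    (hK : ∀ S t, |Φ S t| ≤ K + |t|)
    (hstep : ∀ S i t, 0 ≤ t → σ.next S t = some i →
      ∫ z, Φ (insert i S) (max (w z) t) ∂(A i).dist ≤ Φ S t) :
    ∫ y, Φ (σ.sampled w y) (bestWage w y (σ.sampled w y)) ∂prizeLaw A ≤ Φ ∅ (w 0) := by
  have : ∀ k, ∫ y, Φ (σ.sampledAfter w y k) (bestWage w y (σ.sampledAfter w y k)) ∂prizeLaw A ≤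
      Φ ∅ (w 0) := by
    intro k
    induction k with
    | zero => simp [Strategy.sampledAfter]
    | succ k ih => exact (integral_step_le σ hw hi k hΦ hK hstep).trans ih
  exact this N

/-- Whether a project is sampled is independent of its own prize. -/
theorem integral_indicator_mem_sampled (σ : Strategy N) (hw : IsContract w) (i : Fin N)
    {h : ℝ≥0 → ℝ} (hh : Integrable h (A i).dist) (h0 : ∫ z, h z ∂(A i).dist = 0) :
    ∫ y, {y | i ∈ σ.sampled w y}.indicator (fun y => h (y i)) y ∂prizeLaw A = 0 := by
  unfold prizeLaw
  rw [integral_pi_update _ i ((integrable_comp_eval A i hh).indicator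
    (σ.measurableSet_mem_sampled hw i))]
  refine integral_eq_zero_of_ae (Filter.Eventually.of_forall fun y => ?_)
  by_cases hy : i ∈ σ.sampled w y
  · have : ∀ z, {y | i ∈ σ.sampled w y}.indicator (fun y => h (y i)) (Function.update y i z) =
        h z := by
      intro z
      rw [Set.indicator_of_mem]
      · simp
      · exact (σ.mem_sampledAfter_update z).2 hy
    simp only [this, h0, Pi.zero_apply]
  · have : ∀ z, {y | i ∈ σ.sampled w y}.indicator (fun y => h (y i)) (Function.update y i z) =
        0 := fun z =>
      Set.indicator_of_notMem (s := {y | i ∈ σ.sampled w y})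
        (fun h' => hy ((σ.mem_sampledAfter_update z).1 h')) _
    simp [this]

theorem integrable_wage_sub_cost (σ : Strategy N) (hw : IsContract w)
    (hi : ∀ i, Integrable w (A i).dist) :
    Integrable (fun y => w (σ.prize w y) - ∑ i ∈ σ.sampled w y, ((A i).cost : ℝ))
      (prizeLaw A) := by
  simp only [σ.w_prize]
  refine integrable_state σ hw hi N (Φ := fun S t => t - ∑ i ∈ S, ((A i).cost : ℝ))
    (K := ∑ i, ((A i).cost : ℝ)) (fun S => measurable_id.sub_const _) fun S t => ?_
  have h0 : 0 ≤ ∑ i ∈ S, ((A i).cost : ℝ) := Finset.sum_nonneg fun i _ => (A i).cost.2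
  have h1 : ∑ i ∈ S, ((A i).cost : ℝ) ≤ ∑ i, ((A i).cost : ℝ) :=
    Finset.sum_le_sum_of_subset_of_nonneg (Finset.subset_univ _) fun i _ _ => (A i).cost.2
  refine (abs_sub _ _).trans ?_
  rw [abs_of_nonneg h0]
  linarith

theorem agentPayoff_eq (σ : Strategy N) (hw : IsContract w)
    (hi : ∀ i, Integrable w (A i).dist) :
    agentPayoff w A σ = ((∫ y, (w (σ.prize w y) - ∑ i ∈ σ.sampled w y, ((A i).cost : ℝ))
      ∂prizeLaw A : ℝ) : EReal) :=
  extExp_of_integrable (integrable_wage_sub_cost σ hw hi)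

end Verification

/-- A function of the highest available wage whose slopes lie between zero and one. -/
def HasUnitSlopes (f : ℝ → ℝ) : Prop :=
  ∀ ⦃s t⦄, s ≤ t → f s ≤ f t ∧ f t ≤ f s + (t - s)

namespace HasUnitSlopes

variable {f : ℝ → ℝ}

theorem monotone (hf : HasUnitSlopes f) : Monotone f := fun _ _ h => (hf h).1

theorem measurable (hf : HasUnitSlopes f) : Measurable f := hf.monotone.measurable

theorem abs_le (hf : HasUnitSlopes f) (t : ℝ) : |f t| ≤ |f 0| + |t| := by
  rcases le_total 0 t with h | h
  · have := hf h
    rw [abs_of_nonneg h]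
    rw [_root_.abs_le]
    constructor <;> cases abs_cases (f 0) <;> linarith
  · have := hf h
    rw [abs_of_nonpos h]
    rw [_root_.abs_le]
    constructor <;> cases abs_cases (f 0) <;> linarith

theorem id : HasUnitSlopes fun t => t := fun _ _ h => ⟨h, by linarith⟩

theorem integrable {μ : Measure ℝ≥0} [IsProbabilityMeasure μ] {w : ℝ≥0 → ℝ}
    (hf : HasUnitSlopes f) (hw : IsContract w) (hi : Integrable w μ) (t : ℝ) :
    Integrable (fun z => f (max (w z) t)) μ := by
  refine ((integrable_const (|f 0| + |t|)).add hi).mono'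
    (hf.measurable.comp (hw.measurable.max measurable_const)).aestronglyMeasurable
    (Filter.Eventually.of_forall fun z => (hf.abs_le _).trans ?_)
  have h1 := hw.nonneg z
  have := max_le_add_of_nonneg h1 (abs_nonneg t)
  have := max_le_max_left (w z) (le_abs_self t)
  simp only [Pi.add_apply]
  rw [abs_of_nonneg (h1.trans (le_max_left _ _))]
  linarith

/-- The map `t ↦ max (w z) t` has slopes in `[0, 1]`, and averaging preserves this. With `sup'` it
carries the slope bounds through the Bellman recursion. -/
theorem integral {μ : Measure ℝ≥0} [IsProbabilityMeasure μ] {w : ℝ≥0 → ℝ}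
    (hf : HasUnitSlopes f) (hw : IsContract w) (hi : Integrable w μ) (c : ℝ) :
    HasUnitSlopes fun t => ∫ z, f (max (w z) t) ∂μ - c := by
  intro s t hst
  have hs := hf.integrable hw hi s
  have ht := hf.integrable hw hi t
  constructor
  · exact sub_le_sub_right (integral_mono hs ht fun z => hf.monotone (max_le_max_left _ hst)) _
  · have : ∫ z, f (max (w z) t) ∂μ ≤ ∫ z, (f (max (w z) s) + (t - s)) ∂μ := by
      refine integral_mono ht (hs.add (integrable_const _)) fun z => ?_
      have h1 := (hf (max_le_max_left (w z) hst)).2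
      have h2 : max (w z) t ≤ max (w z) s + (t - s) :=
        max_le (by linarith [le_max_left (w z) s]) (by linarith [le_max_right (w z) s])
      simp only
      linarith
    rw [integral_add hs (integrable_const _)] at this
    simp only [integral_const, probReal_univ, one_smul] at this
    linarith

theorem sup' {ι : Type*} {s : Finset ι} (hs : s.Nonempty) {g : ι → ℝ → ℝ}
    (hg : ∀ i ∈ s, HasUnitSlopes (g i)) : HasUnitSlopes fun t => s.sup' hs fun i => g i t := by
  intro a b hab
  constructor
  · exact Finset.sup'_le _ _ fun i hi =>
      ((hg i hi hab).1).trans (Finset.le_sup' (fun i => g i b) hi)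
  · refine Finset.sup'_le _ _ fun i hi => ((hg i hi hab).2).trans ?_
    have := Finset.le_sup' (fun i => g i a) hi
    linarith

end HasUnitSlopes

/-! ### Dynamic programming: the value function and a measurable optimal decision. -/

section Value

variable {N : ℕ} (w : ℝ≥0 → ℝ) (A : Fin N → Project)

/-- The agent's payoff from stopping (`none`) or from sampling a project (`some i`) if `V` is the
value of continuing the search optimally. -/
noncomputable def continuation (V : Finset (Fin N) → ℝ → ℝ) (S : Finset (Fin N)) :
    Option (Fin N) → ℝ → ℝ
  | none => fun t => t
  | some i => fun t => ∫ z, V (insert i S) (max (w z) t) ∂(A i).dist - (A i).cost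

/-- The value of the search with at most `k` further steps. -/
noncomputable def valueWithin : ℕ → Finset (Fin N) → ℝ → ℝ
  | 0 => fun _ t => t
  | k + 1 => fun S t => (Finset.insertNone Sᶜ).sup' ⟨none, by simp⟩
      fun o => continuation w A (valueWithin k) S o t

/-- The value of the search from a given set of sampled projects and highest available wage. -/
noncomputable def searchValue (S : Finset (Fin N)) (t : ℝ) : ℝ :=
  valueWithin w A (N - S.card) S t

/-- The Bellman equation. The horizon `N - S.card` counts the remaining projects, so sampling one
lowers it by exactly one and the recursion closes. -/
theorem searchValue_eq (S : Finset (Fin N)) (t : ℝ) :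
    searchValue w A S t = (Finset.insertNone Sᶜ).sup' ⟨none, by simp⟩
      fun o => continuation w A (searchValue w A) S o t := by
  have hle : S.card ≤ N := by simpa using Finset.card_le_univ S
  rcases hle.eq_or_lt with h | h
  · have hS : S = Finset.univ := Finset.eq_univ_of_card _ (by simpa using h)
    subst hS
    refine le_antisymm ?_ (Finset.sup'_le _ _ fun o ho => ?_)
    · have := Finset.le_sup' (fun o => continuation w A (searchValue w A) Finset.univ o t)
        (b := none) (s := Finset.insertNone Finset.univᶜ) (by simp)
      refine le_trans ?_ this
      simp [searchValue, valueWithin, continuation]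
    · cases o with
      | none => simp [searchValue, valueWithin, continuation]
      | some i => simp at ho
  · obtain ⟨m, hm⟩ : ∃ m, N - S.card = m + 1 := ⟨N - S.card - 1, by omega⟩
    unfold searchValue
    rw [hm, valueWithin]
    refine Finset.sup'_congr _ rfl fun o ho => ?_
    cases o with
    | none => rfl
    | some i =>
      have hi : i ∉ S := by simpa using ho
      have : N - (insert i S).card = m := by
        rw [Finset.card_insert_of_notMem hi]; omega
      simp only [continuation, this]

variable {w A}

theorem continuation_hasUnitSlopes (hw : IsContract w) (hi : ∀ i, Integrable w (A i).dist)
    {V : Finset (Fin N) → ℝ → ℝ} (hV : ∀ S, HasUnitSlopes (V S)) (S : Finset (Fin N))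
    (o : Option (Fin N)) : HasUnitSlopes (continuation w A V S o) := by
  cases o with
  | none => exact HasUnitSlopes.id
  | some i => exact (hV _).integral hw (hi i) _

theorem searchValue_hasUnitSlopes (hw : IsContract w) (hi : ∀ i, Integrable w (A i).dist)
    (S : Finset (Fin N)) : HasUnitSlopes (searchValue w A S) := by
  have : ∀ k S, HasUnitSlopes (valueWithin w A k S) := by
    intro k
    induction k with
    | zero => exact fun S => HasUnitSlopes.id
    | succ k ih =>
      exact fun S => HasUnitSlopes.sup' ⟨none, by simp⟩ fun o _ =>
        continuation_hasUnitSlopes hw hi ih S o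
  exact this _ S

theorem le_searchValue (S : Finset (Fin N)) (t : ℝ) : t ≤ searchValue w A S t := by
  rw [searchValue_eq]
  exact Finset.le_sup' (fun o => continuation w A (searchValue w A) S o t) (b := none) (by simp)

theorem sampling_le_searchValue {S : Finset (Fin N)} {i : Fin N} (hi : i ∉ S) (t : ℝ) :
    ∫ z, searchValue w A (insert i S) (max (w z) t) ∂(A i).dist - (A i).cost ≤
      searchValue w A S t := by
  rw [searchValue_eq w A S]
  exact Finset.le_sup' (fun o => continuation w A (searchValue w A) S o t) (b := some i)
    (by simpa using hi)

variable (w A)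

open Classical in
/-- The optimal decisions: to end the search or to sample one of the remaining projects. -/
noncomputable def bestDecisions (S : Finset (Fin N)) (t : ℝ) : Finset (Option (Fin N)) :=
  (Finset.insertNone Sᶜ).filter
    fun o => continuation w A (searchValue w A) S o t = searchValue w A S t

theorem bestDecisions_nonempty (S : Finset (Fin N)) (t : ℝ) : (bestDecisions w A S t).Nonempty := by
  obtain ⟨o, ho, ho'⟩ := Finset.exists_mem_eq_sup' (s := Finset.insertNone Sᶜ) ⟨none, by simp⟩
    fun o => continuation w A (searchValue w A) S o t
  refine ⟨o, ?_⟩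
  rw [bestDecisions, Finset.mem_filter, searchValue_eq w A S, ho']
  exact ⟨ho, rfl⟩

open Classical in
/-- A selection of an element from each nonempty set of decisions. -/
noncomputable def select (M : Finset (Option (Fin N))) : Option (Fin N) :=
  if h : M.Nonempty then h.choose else none

/-- An optimal decision. -/
noncomputable def greedy (S : Finset (Fin N)) (t : ℝ) : Option (Fin N) :=
  select (bestDecisions w A S t)

theorem greedy_mem (S : Finset (Fin N)) (t : ℝ) : greedy w A S t ∈ bestDecisions w A S t := by
  rw [greedy, select, dif_pos (bestDecisions_nonempty w A S t)]
  exact (bestDecisions_nonempty w A S t).choose_spec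

variable {w A}

theorem notMem_of_greedy {S : Finset (Fin N)} {t : ℝ} {i : Fin N} (h : greedy w A S t = some i) :
    i ∉ S := by
  have := h ▸ greedy_mem w A S t
  rw [bestDecisions, Finset.mem_filter] at this
  simpa using this.1

theorem continuation_greedy (S : Finset (Fin N)) (t : ℝ) :
    continuation w A (searchValue w A) S (greedy w A S t) t = searchValue w A S t := by
  have := greedy_mem w A S t
  rw [bestDecisions, Finset.mem_filter] at this
  exact this.2

/-- The choice depends on `t` only through the finite set of optimal decisions, and membership in
that set is an equality of two measurable functions of `t`. -/
theorem measurableSet_greedy_eq (hw : IsContract w) (hi : ∀ i, Integrable w (A i).dist)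
    (S : Finset (Fin N)) (o : Option (Fin N)) : MeasurableSet {t | greedy w A S t = o} := by
  have h1 : ∀ M, MeasurableSet {t | bestDecisions w A S t = M} := by
    intro M
    have : {t | bestDecisions w A S t = M} =
        ⋂ o, {t | o ∈ bestDecisions w A S t ↔ o ∈ M} := by
      ext t
      simp only [Set.mem_ofPred_eq, Set.mem_iInter, Finset.ext_iff]
    rw [this]
    refine MeasurableSet.iInter fun o => ?_
    have h2 : MeasurableSet {t | o ∈ bestDecisions w A S t} := by
      simp only [bestDecisions, Finset.mem_filter]
      exact (MeasurableSet.const _).inter (measurableSet_eq_fun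
        (continuation_hasUnitSlopes hw hi (searchValue_hasUnitSlopes hw hi) S o).measurable
        (searchValue_hasUnitSlopes hw hi S).measurable)
    by_cases ho : o ∈ M
    · simpa only [ho, iff_true] using h2
    · simp only [ho, iff_false]
      exact h2.compl
  have : {t | greedy w A S t = o} =
      ⋃ M, {t | bestDecisions w A S t = M} ∩ {_t | select M = o} := by
    ext t
    simp [greedy]
  rw [this]
  exact MeasurableSet.iUnion fun M => (h1 M).inter (MeasurableSet.const _)

end Value

/-! ### Sampling the known project last is optimal and secures its surplus. -/

section Optimality

variable {N : ℕ} {w : ℝ≥0 → ℝ} {A : Fin N → Project}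

theorem exists_growth_bound {Φ : Finset (Fin N) → ℝ → ℝ} (hΦ : ∀ S, HasUnitSlopes (Φ S))
    (c : Finset (Fin N) → ℝ) : ∃ K, ∀ S t, |Φ S t - c S| ≤ K + |t| := by
  refine ⟨∑ S, (|Φ S 0| + |c S|), fun S t => ?_⟩
  have h1 := Finset.single_le_sum (f := fun S => |Φ S 0| + |c S|) (fun S _ => by positivity)
    (Finset.mem_univ S)
  have h2 := (hΦ S).abs_le t
  refine (abs_sub _ _).trans ?_
  linarith

/-- An upper bound on the agent's payoff from any strategy. -/
theorem agentPayoff_le (hw : IsContract w) (hi : ∀ i, Integrable w (A i).dist)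
    {Φ : Finset (Fin N) → ℝ → ℝ} (hΦ : ∀ S, HasUnitSlopes (Φ S)) (hfinal : ∀ S t, t ≤ Φ S t)
    (hstep : ∀ S i t, 0 ≤ t → i ∉ S →
      ∫ z, Φ (insert i S) (max (w z) t) ∂(A i).dist - (A i).cost ≤ Φ S t)
    (σ : Strategy N) : agentPayoff w A σ ≤ (Φ ∅ (w 0) : EReal) := by
  obtain ⟨K, hK⟩ := exists_growth_bound hΦ fun S => ∑ i ∈ S, ((A i).cost : ℝ)
  have hm : ∀ S, Measurable fun t => Φ S t - ∑ i ∈ S, ((A i).cost : ℝ) := fun S =>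
    (hΦ S).measurable.sub_const _
  -- Net of the costs already sunk, `Φ` is a supermartingale along every strategy.
  have key := integral_sampled_le (A := A) σ hw hi hm hK fun S i t ht h => by
    have hiS := σ.fresh _ _ _ h
    have := hstep S i t ht hiS
    rw [integral_sub ((hΦ _).integrable hw (hi i) t) (integrable_const _), Finset.sum_insert hiS]
    simp only [integral_const, probReal_univ, one_smul]
    linarith
  rw [agentPayoff_eq σ hw hi, EReal.coe_le_coe_iff]
  refine le_trans (integral_mono (integrable_wage_sub_cost σ hw hi)
    (integrable_state σ hw hi N hm hK) fun y => ?_) (key.trans (by simp))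
  simp only [σ.w_prize]
  exact sub_le_sub_right (hfinal _ _) _

/-- A lower bound on the agent's payoff from a given strategy. -/
theorem le_agentPayoff (hw : IsContract w) (hi : ∀ i, Integrable w (A i).dist)
    {Φ : Finset (Fin N) → ℝ → ℝ} (hΦ : ∀ S, HasUnitSlopes (Φ S)) (σ : Strategy N)
    (hfinal : ∀ S t, 0 ≤ t → σ.next S t = none → Φ S t ≤ t)
    (hstep : ∀ S i t, 0 ≤ t → σ.next S t = some i →
      Φ S t ≤ ∫ z, Φ (insert i S) (max (w z) t) ∂(A i).dist - (A i).cost) :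
    (Φ ∅ (w 0) : EReal) ≤ agentPayoff w A σ := by
  obtain ⟨K, hK⟩ := exists_growth_bound hΦ fun S => ∑ i ∈ S, ((A i).cost : ℝ)
  have hm : ∀ S, Measurable fun t => Φ S t - ∑ i ∈ S, ((A i).cost : ℝ) := fun S =>
    (hΦ S).measurable.sub_const _
  have key := integral_sampled_le (A := A) σ hw hi
    (Φ := fun S t => -(Φ S t - ∑ i ∈ S, ((A i).cost : ℝ))) (fun S => (hm S).neg) (K := K)
    (fun S t => by rw [abs_neg]; exact hK S t) fun S i t ht h => by
    have hiS := σ.fresh _ _ _ h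
    have := hstep S i t ht h
    rw [integral_neg, integral_sub ((hΦ _).integrable hw (hi i) t) (integrable_const _),
      Finset.sum_insert hiS]
    simp only [integral_const, probReal_univ, one_smul]
    linarith
  rw [integral_neg, neg_le_neg_iff] at key
  rw [agentPayoff_eq σ hw hi, EReal.coe_le_coe_iff]
  refine le_trans (le_trans (by simp) key) (integral_mono
    (integrable_state σ hw hi N hm hK) (integrable_wage_sub_cost σ hw hi) fun y => ?_)
  simp only [σ.w_prize]
  exact sub_le_sub_right (hfinal _ _ (bestWage_nonneg hw) (σ.next_sampled w y)) _

open Classical in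
/-- The strategy that searches optimally among the projects other than `j`, and samples `j`, as the
last project, only if no positive wage has been found. -/
noncomputable def lastResort (hw : IsContract w) (hi : ∀ i, Integrable w (A i).dist) (j : Fin N) :
    Strategy N where
  next S t := if j ∈ S then none else
    -- Treating `j` as already sampled removes it from the agent's choices.
    match greedy w A (insert j S) t with
    | some i => some i
    | none => if t ≤ 0 then some j else none
  fresh S t i h := by
    by_cases hj : j ∈ S
    · rw [if_pos hj] at h
      cases h
    rw [if_neg hj] at h
    cases hg : greedy w A (insert j S) t with
    | some i' =>
      rw [hg] at h
      cases h
      exact fun hS => notMem_of_greedy hg (Finset.mem_insert_of_mem hS)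
    | none =>
      rw [hg] at h
      simp only at h
      split_ifs at h
      cases h
      exact hj
  measurable_next S o := by
    by_cases hj : j ∈ S
    · simp only [hj, if_true]
      exact MeasurableSet.const _
    · simp only [hj, if_false]
      have : {t : ℝ | (match greedy w A (insert j S) t with
          | some i => some i
          | none => if t ≤ 0 then some j else none) = o} =
          ({t | greedy w A (insert j S) t = none} ∩
            (({t | t ≤ 0} ∩ {_t | some j = o}) ∪ ({t | t ≤ 0}ᶜ ∩ {_t | none = o}))) ∪
          ⋃ i, {t | greedy w A (insert j S) t = some i} ∩ {_t | some i = o} := by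
        ext t
        cases hg : greedy w A (insert j S) t with
        | some i => simp [hg]
        | none => by_cases ht : t ≤ 0 <;> simp [hg, ht]
      rw [this]
      have hg := measurableSet_greedy_eq hw hi (insert j S)
      exact ((hg none).inter (((measurableSet_Iic).inter (MeasurableSet.const _)).union
        ((measurableSet_Iic).compl.inter (MeasurableSet.const _)))).union
        (MeasurableSet.iUnion fun i => (hg (some i)).inter (MeasurableSet.const _))

variable (hw : IsContract w) (hi : ∀ i, Integrable w (A i).dist) (j : Fin N)

theorem lastResort_next_of_mem {S : Finset (Fin N)} (hj : j ∈ S) (t : ℝ) :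
    (lastResort hw hi j).next S t = none := if_pos hj

theorem lastResort_next_of_some {S : Finset (Fin N)} (hj : j ∉ S) {t : ℝ} {i : Fin N}
    (hg : greedy w A (insert j S) t = some i) : (lastResort hw hi j).next S t = some i := by
  simp [lastResort, hj, hg]

theorem lastResort_next_of_none {S : Finset (Fin N)} (hj : j ∉ S) {t : ℝ}
    (hg : greedy w A (insert j S) t = none) :
    (lastResort hw hi j).next S t = if t ≤ 0 then some j else none := by
  simp [lastResort, hj, hg]

/-- If the project `j` by itself is worth exactly nothing to the agent, it is optimal to sample it
only as a last resort. -/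
theorem lastResort_optimal (hj : ∫ z, w z ∂(A j).dist = (A j).cost) :
    lastResort hw hi j ∈ optimalStrategies w A := by
  intro σ'
  have hV := searchValue_hasUnitSlopes hw hi
  -- The value of the problem without `j` bounds the payoff of every strategy, including those that
  -- use `j`.
  refine (agentPayoff_le hw hi (Φ := fun S => searchValue w A (insert j S)) (fun S => hV _)
    (fun S t => le_searchValue _ _) (fun S i t ht hiS => ?_) σ').trans ?_
  · by_cases hij : i = j
    · subst hij
      rw [Finset.insert_idem]
      -- By the slope bound, a draw `z` raises the value by at most `w z`, whose mean is just the
      -- cost.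
      have : ∫ z, searchValue w A (insert i S) (max (w z) t) ∂(A i).dist ≤
          ∫ z, (searchValue w A (insert i S) t + w z) ∂(A i).dist := by
        refine integral_mono ((hV _).integrable hw (hi i) t) ((integrable_const _).add (hi i))
          fun z => ?_
        have h1 := (hV (insert i S) (le_max_right (w z) t)).2
        have h2 := max_le_add_of_nonneg (hw.nonneg z) ht
        simp only
        linarith
      rw [integral_add (integrable_const _) (hi i), hj] at this
      simp only [integral_const, probReal_univ, one_smul] at this
      linarith
    · rw [Finset.insert_comm]
      exact sampling_le_searchValue (by simp [hij, hiS]) t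
  · have := le_agentPayoff hw hi
      -- The payoff of `lastResort` itself: it stops once `j` is sampled, and before that it attains
      -- the value without `j`.
      (Φ := fun S t => if j ∈ S then t else searchValue w A (insert j S) t)
      (fun S => by
        by_cases hjS : j ∈ S
        · simpa only [hjS, if_true] using HasUnitSlopes.id
        · simpa only [hjS, if_false] using hV _) (lastResort hw hi j) ?_ ?_
    · simpa using this
    · intro S t ht hn
      by_cases hjS : j ∈ S
      · simp [hjS]
      · simp only [hjS, if_false]
        have hc := continuation_greedy (w := w) (A := A) (insert j S) t
        cases hg : greedy w A (insert j S) t with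
        | some i =>
          rw [lastResort_next_of_some hw hi j hjS hg] at hn
          cases hn
        | none => rw [hg] at hc; exact hc.ge
    · intro S i t ht hn
      have hjS : j ∉ S := fun h => by
        rw [lastResort_next_of_mem hw hi j h] at hn
        cases hn
      have hc := continuation_greedy (w := w) (A := A) (insert j S) t
      simp only [hjS, if_false]
      cases hg : greedy w A (insert j S) t with
      | some i' =>
        rw [lastResort_next_of_some hw hi j hjS hg] at hn
        cases hn
        have hne : j ∉ insert i S := fun h => by
          rcases Finset.mem_insert.1 h with h | h
          · exact notMem_of_greedy hg (h ▸ Finset.mem_insert_self _ _)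
          · exact hjS h
        rw [hg] at hc
        simp only [hne, if_false]
        rw [Finset.insert_comm]
        exact hc.ge
      | none =>
        rw [lastResort_next_of_none hw hi j hjS hg] at hn
        split_ifs at hn with ht0
        cases hn
        have : t = 0 := le_antisymm ht0 ht
        subst this
        rw [hg] at hc
        -- With wage `0` in hand, sampling `j` yields its mean wage minus its cost, which is zero,
        -- as stopping does.
        have hmax : ∀ z, max (w z) 0 = w z := fun z => max_eq_left (hw.nonneg z)
        simp only [Finset.mem_insert_self, if_true, hmax, hj, sub_self]
        exact hc.ge

/-- `j` is opened only when the wage in hand is at most zero, and the search then ends. -/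
theorem lastResort_bestWage {y : Fin N → ℝ≥0} {k : ℕ}
    (hj : j ∈ (lastResort hw hi j).sampledAfter w y k) :
    bestWage w y ((lastResort hw hi j).sampledAfter w y k) = w (y j) := by
  set σ := lastResort hw hi j with hσ
  induction k with
  | zero => simp [Strategy.sampledAfter] at hj
  | succ k ih =>
    by_cases hjk : j ∈ σ.sampledAfter w y k
    · rw [σ.sampledAfter_succ_of_none (lastResort_next_of_mem hw hi j hjk _), ih hjk]
    · cases hn : σ.next (σ.sampledAfter w y k) (bestWage w y (σ.sampledAfter w y k)) with
      | none => exact absurd (σ.sampledAfter_succ_of_none hn ▸ hj) hjk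
      | some i =>
        rw [σ.sampledAfter_succ_of_some hn] at hj ⊢
        have hij : i = j := by
          rcases Finset.mem_insert.1 hj with h | h
          · exact h.symm
          · exact absurd h hjk
        subst hij
        rw [bestWage_insert]
        refine max_eq_left ?_
        cases hg : greedy w A (insert i (σ.sampledAfter w y k))
            (bestWage w y (σ.sampledAfter w y k)) with
        | some i' =>
          rw [hσ, lastResort_next_of_some hw hi i hjk hg] at hn
          cases hn
          exact absurd (Finset.mem_insert_self _ _) (notMem_of_greedy hg)
        | none =>
          rw [hσ, lastResort_next_of_none hw hi i hjk hg] at hn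
          split_ifs at hn with h0
          exact h0.trans (hw.nonneg _)

/-- If the wage leaves at least `s` to the principal whenever it is positive, and the project `j`
by itself is worth `s` to him and nothing to the agent, then the principal obtains at least `s`. -/
theorem le_principalValue (hw : IsContract w) (hi : ∀ i, Integrable w (A i).dist) (j : Fin N)
    {s : ℝ} (hws : ∀ y : ℝ≥0, w y ≤ max ((y : ℝ) - s) 0)
    (hj : ∫ z, w z ∂(A j).dist = (A j).cost) (hs : (A j).surplus = s) :
    (s : EReal) ≤ principalValue w A := by
  refine le_trans ?_ (le_iSup₂ (f := fun σ _ => principalPayoff w A σ) (lastResort hw hi j)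
    (lastResort_optimal hw hi j hj))
  set σ := lastResort hw hi j with hσ
  have hint : Integrable (fun z : ℝ≥0 => (z : ℝ) - w z - s) (A j).dist :=
    ((A j).finiteMean.sub (hi j)).sub (integrable_const s)
  have hzero : ∫ z : ℝ≥0, ((z : ℝ) - w z - s) ∂(A j).dist = 0 := by
    have h1 := integral_sub ((A j).finiteMean.sub (hi j)) (integrable_const s)
    have h2 := integral_sub (A j).finiteMean (hi j)
    simp only [Pi.sub_apply, integral_const, probReal_univ, one_smul] at h1 h2
    rw [h1, h2, hj, ← hs, Project.surplus, sub_self]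
  have hI := (integrable_comp_eval A j hint).indicator (σ.measurableSet_mem_sampled hw j)
  -- This variable has mean `s` because sampling `j` is independent of its prize; it bounds the
  -- principal's realized payoff from below pointwise.
  have hE : ∫ y, (s + {y | j ∈ σ.sampled w y}.indicator
      (fun y => (y j : ℝ) - w (y j) - s) y) ∂prizeLaw A = s := by
    rw [integral_add (integrable_const s) hI,
      integral_indicator_mem_sampled σ hw j hint hzero]
    simp
  refine (congrArg Real.toEReal hE).ge.trans ?_
  refine (extExp_of_integrable ((integrable_const s).add hI)).ge.trans ?_
  refine extExp_mono fun y => ?_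
  simp only [Pi.add_apply]
  have hwp := σ.w_prize w y
  by_cases hjy : j ∈ σ.sampled w y
  · have hb : bestWage w y (σ.sampled w y) = w (y j) := lastResort_bestWage hw hi j hjy
    rw [Set.indicator_of_mem (by exact hjy)]
    have : (y j : ℝ) ≤ σ.prize w y := NNReal.coe_le_coe.2 (le_presentedPrize hjy hb.symm)
    linarith
  · rw [Set.indicator_of_notMem (by exact hjy), add_zero]
    -- Stopping without `j` requires a positive wage, so the debt bound reads `w ≤ y - s` at the
    -- presented prize.
    have hpos : 0 < w (σ.prize w y) := by
      rw [hwp]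
      have hn := σ.next_sampled w y
      cases hg : greedy w A (insert j (σ.sampled w y)) (bestWage w y (σ.sampled w y)) with
      | some i =>
        rw [hσ, lastResort_next_of_some hw hi j hjy hg] at hn
        cases hn
      | none =>
        rw [hσ, lastResort_next_of_none hw hi j hjy hg] at hn
        split_ifs at hn with h0
        exact not_le.1 h0
    have := hws (σ.prize w y)
    rcases le_max_iff.1 this with h | h <;> linarith

end Optimality

/-! ### Two deviations against which optimality is tested. -/

namespace Strategy

variable {N : ℕ}

/-- The strategy that samples nothing. -/
def idle (N : ℕ) : Strategy N where
  next _ _ := none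
  fresh _ _ _ h := by cases h
  measurable_next _ _ := MeasurableSet.const _

/-- The strategy that samples a single project. -/
def sampleOnly (i : Fin N) : Strategy N where
  next S _ := if i ∈ S then none else some i
  fresh S _ j h := by
    split_ifs at h with hi
    cases h
    exact hi
  measurable_next _ _ := MeasurableSet.const _

variable {w : ℝ≥0 → ℝ} {y : Fin N → ℝ≥0}

theorem sampled_idle : (idle N).sampled w y = ∅ := by
  have : ∀ k, (idle N).sampledAfter w y k = ∅ := by
    intro k
    induction k with
    | zero => rfl
    | succ k ih => rw [(idle N).sampledAfter_succ_of_none rfl, ih]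
  exact this N

theorem sampled_sampleOnly (i : Fin N) : (sampleOnly i).sampled w y = {i} := by
  have : ∀ k, (sampleOnly i).sampledAfter w y (k + 1) = {i} := by
    intro k
    induction k with
    | zero => rfl
    | succ k ih =>
      rw [sampledAfter_succ_of_none, ih]
      rw [ih]
      simp [sampleOnly]
  obtain ⟨m, rfl⟩ : ∃ m, N = m + 1 := ⟨N - 1, by have := i.2; omega⟩
  exact this m

end Strategy

/-! ### The known project alone: full surplus extraction is necessary. -/

section SingleProject

variable {w : ℝ≥0 → ℝ} {A : Fin 1 → Project}

/-- With a single project, a strategy either stops at once or samples the project. -/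
theorem sampled_single (w : ℝ≥0 → ℝ) (σ : Strategy 1) :
    (∀ y, σ.sampled w y = ∅) ∨ ∀ y, σ.sampled w y = {0} := by
  have h0 : ∀ y : Fin 1 → ℝ≥0, bestWage w y (σ.sampledAfter w y 0) = w 0 := fun y =>
    bestWage_empty
  cases h : σ.next ∅ (w 0) with
  | none =>
    left
    intro y
    exact σ.sampledAfter_succ_of_none (k := 0) (by rw [h0]; exact h)
  | some i =>
    right
    intro y
    rw [← Subsingleton.elim i 0]
    exact σ.sampledAfter_succ_of_some (k := 0) (by rw [h0]; exact h)

theorem agentPayoff_of_sampled_empty {N : ℕ} {A : Fin N → Project} {σ : Strategy N}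
    (h : ∀ y, σ.sampled w y = ∅) : agentPayoff w A σ = (w 0 : EReal) := by
  unfold agentPayoff
  simp only [σ.w_prize, h, bestWage_empty, Finset.sum_empty, sub_zero]
  exact extExp_const _

theorem principalPayoff_of_sampled_empty {N : ℕ} {A : Fin N → Project} {σ : Strategy N}
    (h : ∀ y, σ.sampled w y = ∅) : principalPayoff w A σ = ((-w 0 : ℝ) : EReal) := by
  have hp : ∀ y, σ.prize w y = 0 := by
    intro y
    rcases (presentedPrize_spec w y (σ.sampled w y)).1 with h' | ⟨i, hi, _⟩
    · exact h'
    · rw [h] at hi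
      simp at hi
  unfold principalPayoff
  simp only [hp, NNReal.coe_zero, zero_sub]
  exact extExp_const _

theorem bestWage_singleton {N : ℕ} {y : Fin N → ℝ≥0} (i : Fin N) :
    bestWage w y {i} = max (w (y i)) (w 0) := by
  rw [← insert_empty_eq, bestWage_insert, bestWage_empty]

theorem agentPayoff_of_sampled_singleton {N : ℕ} {A : Fin N → Project} {σ : Strategy N}
    {i : Fin N} (h : ∀ y, σ.sampled w y = {i}) :
    agentPayoff w A σ = extExp (prizeLaw A) fun y => max (w (y i)) (w 0) - (A i).cost := by
  unfold agentPayoff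
  simp only [σ.w_prize, h, bestWage_singleton, Finset.sum_singleton]

theorem principalPayoff_le_of_sampled_singleton {N : ℕ} {A : Fin N → Project} {σ : Strategy N}
    {i : Fin N} (h : ∀ y, σ.sampled w y = {i}) :
    principalPayoff w A σ ≤ extExp (prizeLaw A) fun y => (y i : ℝ) - max (w (y i)) (w 0) := by
  refine extExp_mono fun y => ?_
  rw [σ.w_prize w y, h, bestWage_singleton]
  refine sub_le_sub_right (NNReal.coe_le_coe.2 ?_) _
  rcases (presentedPrize_spec w y (σ.sampled w y)).1 with h' | ⟨j, hj, hj'⟩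
  · unfold Strategy.prize
    rw [h']
    exact zero_le
  · rw [h, Finset.mem_singleton] at hj
    subst hj
    exact hj'.ge

theorem integrable_max_wage {μ : Measure ℝ≥0} [IsProbabilityMeasure μ] (hI : Integrable w μ) :
    Integrable (fun z => max (w z) (w 0)) μ :=
  hI.sup (integrable_const _)

theorem not_integrable_max_wage {N : ℕ} {A : Fin N → Project} (i : Fin N) (hw : IsContract w)
    (hI : ¬ Integrable w (A i).dist) :
    ¬ Integrable (fun y : Fin N → ℝ≥0 => max (w (y i)) (w 0)) (prizeLaw A) := by
  intro h
  refine hI ?_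
  have hmp := measurePreserving_eval (fun i => (A i).dist) i
  rw [← hmp.integrable_comp hw.measurable.aestronglyMeasurable]
  refine h.mono' (hw.measurable.comp (measurable_pi_apply i)).aestronglyMeasurable
    (Filter.Eventually.of_forall fun y => ?_)
  exact (Real.norm_of_nonneg (hw.nonneg _)).trans_le (le_max_left _ _)

theorem extExp_wage_sub_cost {N : ℕ} (A : Fin N → Project) (i : Fin N)
    (hI : Integrable w (A i).dist) :
    extExp (prizeLaw A) (fun y => max (w (y i)) (w 0) - (A i).cost) =
      ((∫ z, max (w z) (w 0) ∂(A i).dist - (A i).cost : ℝ) : EReal) := by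
  have h := integrable_comp_eval A i (integrable_max_wage hI)
  refine (extExp_of_integrable (h.sub (integrable_const _))).trans ?_
  rw [integral_sub' h (integrable_const _), integral_comp_eval A i (integrable_max_wage hI)]
  simp

theorem extExp_prize_sub_wage {N : ℕ} (A : Fin N → Project) (i : Fin N)
    (hI : Integrable w (A i).dist) :
    extExp (prizeLaw A) (fun y => (y i : ℝ) - max (w (y i)) (w 0)) =
      (((A i).surplus - (∫ z, max (w z) (w 0) ∂(A i).dist - (A i).cost) : ℝ) : EReal) := by
  have h := integrable_comp_eval A i (integrable_max_wage hI)
  have h' := integrable_comp_eval A i (A i).finiteMean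
  refine (extExp_of_integrable (h'.sub h)).trans ?_
  rw [integral_sub' h' h,
    integral_comp_eval A i (integrable_max_wage hI), integral_comp_eval A i (A i).finiteMean]
  congr 1
  unfold Project.surplus
  ring

theorem extExp_wage_sub_cost_eq_top {N : ℕ} (A : Fin N → Project) (i : Fin N)
    (hw : IsContract w) (hI : ¬ Integrable w (A i).dist) :
    extExp (prizeLaw A) (fun y => max (w (y i)) (w 0) - (A i).cost) = ⊤ := by
  refine extExp_eq_top (g := fun _ => -((A i).cost : ℝ)) ?_ (integrable_const _)
    (Filter.Eventually.of_forall fun y => ?_) fun h => ?_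
  · exact (((hw.measurable.comp (measurable_pi_apply i)).max
      measurable_const).sub_const _).aestronglyMeasurable
  · have := (hw.nonneg _).trans (le_max_left (w (y i)) (w 0))
    simp only
    linarith
  · refine not_integrable_max_wage i hw hI ?_
    exact (h.add (integrable_const ((A i).cost : ℝ))).congr
      (Filter.Eventually.of_forall fun y => sub_add_cancel _ _)

theorem extExp_prize_sub_wage_eq_bot {N : ℕ} (A : Fin N → Project) (i : Fin N)
    (hw : IsContract w) (hI : ¬ Integrable w (A i).dist) :
    extExp (prizeLaw A) (fun y => (y i : ℝ) - max (w (y i)) (w 0)) = ⊥ := by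
  have h' := integrable_comp_eval A i (A i).finiteMean
  have := extExp_neg (μ := prizeLaw A) (f := fun y => max (w (y i)) (w 0) - (y i : ℝ))
    (extExp_eq_top (g := fun y => -(y i : ℝ)) ?_ h'.neg
      (Filter.Eventually.of_forall fun y => ?_) fun h => ?_)
  · simpa using this
  · exact (((hw.measurable.comp (measurable_pi_apply i)).max measurable_const).sub
      (measurable_pi_apply i).coe_nnreal_real).aestronglyMeasurable
  · have := (hw.nonneg _).trans (le_max_left (w (y i)) (w 0))
    simp only
    linarith
  · refine not_integrable_max_wage i hw hI ?_
    exact (h.add h').congr (Filter.Eventually.of_forall fun y => sub_add_cancel _ _)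

/-- Since he can idle, the agent keeps at least `w 0` of the surplus if he samples; if he idles, the
principal just pays `w 0`. -/
theorem principalValue_single_le (hw : IsContract w) (hs : 0 ≤ (A 0).surplus) :
    principalValue w A ≤ (((A 0).surplus - w 0 : ℝ) : EReal) := by
  refine iSup₂_le fun σ hσ => ?_
  rcases sampled_single w σ with h | h
  · rw [principalPayoff_of_sampled_empty h, EReal.coe_le_coe_iff]
    linarith
  · refine (principalPayoff_le_of_sampled_singleton h).trans ?_
    by_cases hI : Integrable w (A 0).dist
    · have h1 := hσ (Strategy.idle 1)
      rw [agentPayoff_of_sampled_empty (fun _ => Strategy.sampled_idle),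
        agentPayoff_of_sampled_singleton h, extExp_wage_sub_cost A 0 hI,
        EReal.coe_le_coe_iff] at h1
      rw [extExp_prize_sub_wage A 0 hI, EReal.coe_le_coe_iff]
      linarith
    · rw [extExp_prize_sub_wage_eq_bot A 0 hw hI]
      exact bot_le

/-- If the principal extracts the full surplus of a single project, then the agent is paid exactly
the cost of sampling it. -/
theorem integral_wage_eq_cost (hw : IsContract w) (hs : (A 0).cost = 0 ∨ 0 < (A 0).surplus)
    (hs0 : 0 ≤ (A 0).surplus) (h : ((A 0).surplus : EReal) ≤ principalValue w A) :
    w 0 = 0 ∧ Integrable w (A 0).dist ∧ ∫ z, w z ∂(A 0).dist = (A 0).cost := by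
  have hw0 : w 0 = 0 := by
    have := h.trans (principalValue_single_le hw hs0)
    rw [EReal.coe_le_coe_iff] at this
    exact le_antisymm (by linarith) (hw.nonneg 0)
  have hmax : ∀ z, max (w z) (w 0) = w z := fun z => by
    rw [hw0]; exact max_eq_left (hw.nonneg z)
  -- An infinite expected wage makes the agent sample and costs the principal `⊥`.
  have hI : Integrable w (A 0).dist := by
    by_contra hI
    have : principalValue w A ≤ ⊥ := by
      refine iSup₂_le fun σ hσ => ?_
      rcases sampled_single w σ with h | h
      · have h1 := hσ (Strategy.sampleOnly 0)
        rw [agentPayoff_of_sampled_empty h,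
          agentPayoff_of_sampled_singleton (fun _ => Strategy.sampled_sampleOnly 0),
          extExp_wage_sub_cost_eq_top A 0 hw hI, top_le_iff] at h1
        exact absurd h1 (EReal.coe_ne_top _)
      · exact (principalPayoff_le_of_sampled_singleton h).trans
          (extExp_prize_sub_wage_eq_bot A 0 hw hI).le
    exact EReal.coe_ne_bot _ (le_bot_iff.1 (h.trans this))
  refine ⟨hw0, hI, le_antisymm ?_ ?_⟩
  -- Wage above cost: the agent surely samples and the principal loses the rent.
  · by_contra! hlt
    have : principalValue w A ≤
        (((A 0).surplus - (∫ z, w z ∂(A 0).dist - (A 0).cost) : ℝ) : EReal) := by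
      refine iSup₂_le fun σ hσ => ?_
      rcases sampled_single w σ with h | h
      · have h1 := hσ (Strategy.sampleOnly 0)
        rw [agentPayoff_of_sampled_empty h,
          agentPayoff_of_sampled_singleton (fun _ => Strategy.sampled_sampleOnly 0),
          extExp_wage_sub_cost A 0 hI, EReal.coe_le_coe_iff] at h1
        simp only [hmax] at h1
        linarith
      · refine (principalPayoff_le_of_sampled_singleton h).trans ?_
        rw [extExp_prize_sub_wage A 0 hI]
        simp only [hmax, le_refl]
    have := h.trans this
    rw [EReal.coe_le_coe_iff] at this
    linarith
  -- Wage below cost: the agent idles and the principal gets zero. This contradicts a positive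
  -- surplus, and at zero cost it contradicts `w ≥ 0`.
  · by_contra! hlt
    have : principalValue w A ≤ ((0 : ℝ) : EReal) := by
      refine iSup₂_le fun σ hσ => ?_
      rcases sampled_single w σ with h | h
      · rw [principalPayoff_of_sampled_empty h, hw0, neg_zero]
      · have h1 := hσ (Strategy.idle 1)
        rw [agentPayoff_of_sampled_empty (fun _ => Strategy.sampled_idle),
          agentPayoff_of_sampled_singleton h, extExp_wage_sub_cost A 0 hI,
          EReal.coe_le_coe_iff] at h1
        simp only [hmax] at h1
        linarith
    have := h.trans this
    rw [EReal.coe_le_coe_iff] at this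
    rcases hs with hs | hs
    · rw [hs, NNReal.coe_zero] at hlt
      exact absurd (integral_nonneg hw.nonneg) (not_le.2 hlt)
    · linarith

end SingleProject

/-! ### A free certain prize: the debt bound is necessary. -/

section CertainPrize

/-- The costless project with a certain prize. -/
noncomputable def certainProject (p : ℝ≥0) : Project where
  dist := Measure.dirac p
  isProbabilityMeasure := inferInstance
  finiteMean := integrable_dirac (by simp)
  cost := 0

variable {w : ℝ≥0 → ℝ} {A : Fin 2 → Project} {p : ℝ≥0}

/-- If sampling one project by itself is worth nothing to the agent, and the other project yields
a certain prize with a positive wage at no cost, then the agent presents the certain prize. -/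
theorem principalPayoff_eq_of_certainProject (hw : IsContract w) (hw0 : w 0 = 0)
    (hI : Integrable w (A 0).dist) (hc : ∫ z, w z ∂(A 0).dist = (A 0).cost)
    (hA : A 1 = certainProject p) (hp : 0 < w p) {σ : Strategy 2}
    (hσ : σ ∈ optimalStrategies w A) :
    principalPayoff w A σ = (((p : ℝ) - w p : ℝ) : EReal) := by
  have hdist : (A 1).dist = Measure.dirac p := by rw [hA]; rfl
  have hcost : (A 1).cost = 0 := by rw [hA]; rfl
  have hi : ∀ i, Integrable w (A i).dist := by
    intro i
    fin_cases i
    · exact hI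
    · change Integrable w (A 1).dist
      rw [hdist]
      exact integrable_dirac (by simp)
  have hyp : ∀ᵐ y ∂prizeLaw A, y 1 = p := by
    have hmp := measurePreserving_eval (fun i => (A i).dist) 1
    refine hmp.quasiMeasurePreserving.ae (p := fun z => z = p) ?_
    rw [hdist]
    exact (ae_dirac_iff (measurableSet_singleton p)).2 rfl
  have hint := integrable_wage_sub_cost σ hw hi
  have hh : Integrable (fun z => w z - (A 0).cost) (A 0).dist := hI.sub (integrable_const _)
  have hint' := (integrable_comp_eval A 0 hh).indicator (σ.measurableSet_mem_sampled hw 0)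
  have hzero := integral_indicator_mem_sampled (A := A) σ hw 0 hh (by
    rw [integral_sub hI (integrable_const _), hc]; simp)
  set P : (Fin 2 → ℝ≥0) → ℝ := fun y =>
    w (σ.prize w y) - ∑ i ∈ σ.sampled w y, ((A i).cost : ℝ) with hP
  -- The stand-alone net gain from project `0` has mean zero, so subtracting it leaves the agent's
  -- expected payoff unchanged.
  set I : (Fin 2 → ℝ≥0) → ℝ := {y | 0 ∈ σ.sampled w y}.indicator
    fun y => w (y 0) - (A 0).cost with hIdef
  have hlow : w p ≤ ∫ y, P y ∂prizeLaw A := by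
    have h1 := hσ (Strategy.sampleOnly 1)
    rw [agentPayoff_of_sampled_singleton (fun _ => Strategy.sampled_sampleOnly 1),
      extExp_wage_sub_cost A 1 (hi 1), agentPayoff_eq σ hw hi, EReal.coe_le_coe_iff, hdist,
      hcost, integral_dirac, hw0, max_eq_left hp.le, NNReal.coe_zero, sub_zero] at h1
    exact h1
  have hcosts : ∀ y, P y - I y = bestWage w y (σ.sampled w y) -
      if 0 ∈ σ.sampled w y then w (y 0) else 0 := by
    intro y
    have hsum : ∑ i ∈ σ.sampled w y, ((A i).cost : ℝ) =
        if 0 ∈ σ.sampled w y then ((A 0).cost : ℝ) else 0 := by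
      rw [← Finset.sum_ite_mem_eq, Fin.sum_univ_two, hcost]
      simp
    simp only [hP, hIdef, hsum, σ.w_prize, Set.indicator_apply, Set.mem_ofPred_eq]
    split_ifs <;> ring
  have hbest : ∀ y, y 1 = p → bestWage w y (σ.sampled w y) ≤
      max (if 0 ∈ σ.sampled w y then w (y 0) else 0) (w p) := by
    intro y hy
    refine bestWage_le_iff.2 ⟨?_, fun i his => ?_⟩
    · rw [hw0]
      exact hp.le.trans (le_max_right _ _)
    · obtain rfl | rfl : i = 0 ∨ i = 1 := by omega
      · rw [if_pos his]
        exact le_max_left _ _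
      · rw [hy]
        exact le_max_right _ _
  have hD : ∀ y, 0 ≤ if 0 ∈ σ.sampled w y then w (y 0) else 0 := fun y => by
    split_ifs
    · exact hw.nonneg _
    · exact le_rfl
  have hnn : 0 ≤ᵐ[prizeLaw A] fun y => w p - (P y - I y) := by
    filter_upwards [hyp] with y hy
    rw [hcosts]
    have := (hbest y hy).trans (max_le_add_of_nonneg (hD y) hp.le)
    simp only [Pi.zero_apply]
    linarith
  have hint2 : Integrable (fun y => w p - (P y - I y)) (prizeLaw A) :=
    (integrable_const _).sub (hint.sub hint')
  -- Almost surely `P - I ≤ w p`, because a maximum is at most the sum; yet its mean is at least `w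
  -- p`. So equality holds almost surely.
  have hae : (fun y => w p - (P y - I y)) =ᵐ[prizeLaw A] 0 := by
    rw [← integral_eq_zero_iff_of_nonneg_ae hnn hint2]
    refine le_antisymm ?_ (integral_nonneg_of_ae hnn)
    have h1 := integral_sub (integrable_const (w p)) (hint.sub hint')
    have h2 := integral_sub hint hint'
    simp only [Pi.sub_apply, integral_const, probReal_univ, one_smul] at h1 h2
    rw [h1, h2, hzero]
    linarith
  have hprize : ∀ᵐ y ∂prizeLaw A, σ.prize w y = p := by
    filter_upwards [hyp, hae] with y hy hy'
    simp only [Pi.zero_apply, hcosts] at hy'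
    have hb := hbest y hy
    -- A maximum with `w p > 0` equals the sum only if the other term vanishes. Project `0` thus
    -- offers no positive wage, and only `p` can be presented.
    have hD0 : (if 0 ∈ σ.sampled w y then w (y 0) else 0) = 0 := by
      refine le_antisymm ?_ (hD y)
      rcases le_max_iff.1 hb with h | h <;> linarith [hD y]
    rw [hD0] at hy'
    have hwp : w (σ.prize w y) = w p := by
      rw [σ.w_prize w y]
      linarith
    rcases (presentedPrize_spec w y (σ.sampled w y)).1 with h | ⟨i, his, h⟩
    · have : σ.prize w y = 0 := h
      rw [this, hw0] at hwp
      exact absurd hwp hp.ne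
    · have h : y i = σ.prize w y := h
      obtain rfl | rfl : i = 0 ∨ i = 1 := by omega
      · rw [if_pos his, h, hwp] at hD0
        exact absurd hD0 hp.ne'
      · rw [← h, hy]
  unfold principalPayoff
  rw [extExp_congr_ae (g := fun _ => (p : ℝ) - w p), extExp_const]
  filter_upwards [hprize] with y hy
  rw [hy]

end CertainPrize

/-! ### The value of the maximal guarantee and the two conditions. -/

section Guarantee

variable {a₀ : Project} {w : ℝ≥0 → ℝ}

theorem surplus_nonneg (hs : a₀.cost = 0 ∨ 0 < a₀.surplus) : 0 ≤ a₀.surplus := by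
  rcases hs with hs | hs
  · rw [Project.surplus, hs, NNReal.coe_zero, sub_zero]
    exact integral_nonneg fun y => y.2
  · exact hs.le

theorem guarantee_le_principalValue (a₀ : Project) (w : ℝ≥0 → ℝ) {n : ℕ} (b : Fin n → Project) :
    guarantee a₀ w ≤ principalValue w (withKnown a₀ b) := by
  unfold guarantee
  exact iInf_le_of_le n (iInf_le (fun b => principalValue w (withKnown a₀ b)) b)

theorem guarantee_le_surplus (hs : 0 ≤ a₀.surplus) (hw : IsContract w) :
    guarantee a₀ w ≤ (a₀.surplus : EReal) := by
  let b : Fin 0 → Project := fun i => i.elim0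
  refine (guarantee_le_principalValue a₀ w b).trans
    ((principalValue_single_le (A := withKnown a₀ b) hw hs).trans ?_)
  rw [EReal.coe_le_coe_iff]
  exact sub_le_self _ (hw.nonneg 0)

theorem surplus_le_guarantee (hs : 0 ≤ a₀.surplus) (hw : IsContract w)
    (hdebt : ∀ y : ℝ≥0, w y ≤ max ((y : ℝ) - a₀.surplus) 0)
    (hcost : ∫ y, w y ∂a₀.dist = a₀.cost) :
    (a₀.surplus : EReal) ≤ guarantee a₀ w := by
  -- Thus wages are integrable for every unknown project as well.
  have hle : ∀ y : ℝ≥0, w y ≤ y := fun y =>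
    (hdebt y).trans (max_le (sub_le_self _ hs) y.2)
  refine le_iInf₂ fun n b => ?_
  refine le_principalValue hw (fun i => ?_) 0 hdebt hcost rfl
  refine (withKnown a₀ b i).finiteMean.mono' hw.measurable.aestronglyMeasurable
    (Filter.Eventually.of_forall fun y => ?_)
  rw [Real.norm_of_nonneg (hw.nonneg y)]
  exact hle y

/-- The debt contract `[y - s]⁺` has mean `M` at least `E[y] - s`, which is the cost; scaling it by
`cost / M ≤ 1` hits the cost and keeps the bound. -/
theorem exists_extracting_contract (a₀ : Project) :
    ∃ w : ℝ≥0 → ℝ, IsContract w ∧ (∀ y : ℝ≥0, w y ≤ max ((y : ℝ) - a₀.surplus) 0) ∧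
      ∫ y, w y ∂a₀.dist = a₀.cost := by
  rcases eq_or_ne a₀.cost 0 with hc | hc
  · exact ⟨fun _ => 0, ⟨measurable_const, fun _ => le_rfl⟩, fun y => le_max_right _ _,
      by simp [hc]⟩
  · have hpos : (0 : ℝ) < a₀.cost := NNReal.coe_pos.2 (pos_iff_ne_zero.2 hc)
    set M := ∫ y : ℝ≥0, max ((y : ℝ) - a₀.surplus) 0 ∂a₀.dist with hM
    have hint : Integrable (fun y : ℝ≥0 => (y : ℝ) - a₀.surplus) a₀.dist :=
      a₀.finiteMean.sub (integrable_const _)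
    have hle : (a₀.cost : ℝ) ≤ M := by
      have h1 : ∫ y : ℝ≥0, ((y : ℝ) - a₀.surplus) ∂a₀.dist ≤ M :=
        integral_mono hint hint.pos_part fun y => le_max_left _ _
      have h2 := integral_sub a₀.finiteMean (integrable_const a₀.surplus)
      simp only [integral_const, probReal_univ, one_smul] at h2
      have h3 : a₀.surplus = (∫ y, (y : ℝ) ∂a₀.dist) - a₀.cost := rfl
      linarith
    have hMpos := hpos.trans_le hle
    refine ⟨fun y => a₀.cost / M * max ((y : ℝ) - a₀.surplus) 0, ⟨?_, fun y => ?_⟩, fun y => ?_, ?_⟩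
    · exact ((measurable_coe_nnreal_real.sub_const _).max measurable_const).const_mul _
    · exact mul_nonneg (div_nonneg hpos.le hMpos.le) (le_max_right _ _)
    · exact mul_le_of_le_one_left (le_max_right _ _) ((div_le_one hMpos).2 hle)
    · rw [integral_const_mul, ← hM, div_mul_cancel₀ _ hMpos.ne']

theorem optimalGuarantee_eq_surplus (hs : a₀.cost = 0 ∨ 0 < a₀.surplus) :
    optimalGuarantee a₀ = (a₀.surplus : EReal) := by
  have hs0 := surplus_nonneg hs
  refine le_antisymm (iSup₂_le fun w hw => guarantee_le_surplus hs0 hw) ?_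
  obtain ⟨w, hw, hdebt, hcost⟩ := exists_extracting_contract a₀
  exact (surplus_le_guarantee hs0 hw hdebt hcost).trans
    (le_iSup₂ (f := fun w (_ : IsContract w) => guarantee a₀ w) w hw)

theorem extraction_of_surplus_le_guarantee (hs : a₀.cost = 0 ∨ 0 < a₀.surplus)
    (hw : IsContract w) (h : (a₀.surplus : EReal) ≤ guarantee a₀ w) :
    w 0 = 0 ∧ Integrable w a₀.dist ∧ ∫ y, w y ∂a₀.dist = a₀.cost := by
  let b : Fin 0 → Project := fun i => i.elim0
  exact integral_wage_eq_cost (A := withKnown a₀ b) hw hs (surplus_nonneg hs)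
    (h.trans (guarantee_le_principalValue a₀ w b))

theorem debt_of_surplus_le_guarantee (hs : a₀.cost = 0 ∨ 0 < a₀.surplus)
    (hw : IsContract w) (h : (a₀.surplus : EReal) ≤ guarantee a₀ w) (y : ℝ≥0) :
    w y ≤ max ((y : ℝ) - a₀.surplus) 0 := by
  obtain ⟨hw0, hI, hc⟩ := extraction_of_surplus_le_guarantee hs hw h
  by_contra! hlt
  obtain ⟨h1, h2⟩ := max_lt_iff.1 hlt
  have : principalValue w (withKnown a₀ fun _ : Fin 1 => certainProject y) ≤
      (((y : ℝ) - w y : ℝ) : EReal) := iSup₂_le fun σ hσ =>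
    (principalPayoff_eq_of_certainProject (A := withKnown a₀ fun _ : Fin 1 => certainProject y)
      hw hw0 hI hc rfl h2 hσ).le
  have := (h.trans (guarantee_le_principalValue a₀ w _)).trans this
  rw [EReal.coe_le_coe_iff] at this
  linarith

end Guarantee

end DelegatedSearch

/-- Integrability is part of the second condition because the Bochner integral of a nonintegrable
wage is `0` by default, which could pass for a zero cost. -/
theorem theorem1 (a₀ : DelegatedSearch.Project) (hs : a₀.cost = 0 ∨ 0 < a₀.surplus)
    (w : ℝ≥0 → ℝ) (hw : DelegatedSearch.IsContract w) :
    DelegatedSearch.RobustlyOptimal a₀ w ↔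
      (∀ y : ℝ≥0, w y ≤ max ((y : ℝ) - a₀.surplus) 0) ∧
      (Integrable w a₀.dist ∧ ∫ y, w y ∂a₀.dist = a₀.cost) := by
  have hs0 := DelegatedSearch.surplus_nonneg hs
  rw [DelegatedSearch.RobustlyOptimal, DelegatedSearch.optimalGuarantee_eq_surplus hs]
  constructor
  · rintro ⟨_, h⟩
    exact ⟨DelegatedSearch.debt_of_surplus_le_guarantee hs hw h.ge,
      (DelegatedSearch.extraction_of_surplus_le_guarantee hs hw h.ge).2⟩
  · rintro ⟨hdebt, _, hcost⟩
    exact ⟨hw, le_antisymm (DelegatedSearch.guarantee_le_surplus hs0 hw)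
      (DelegatedSearch.surplus_le_guarantee hs0 hw hdebt hcost)⟩
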